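/- For a topological space $X$ let $C_s(X)$ be the set of all continuous functions $f : X \to \mathbb{R}$ with the topology of uniform convergence on countable subsets of $X$, in which the sets $\{g \in C_s(X) : |f(x)-g(x)|<\varepsilon \text{ for all } x \in A\}$, with $A \subseteq X$ countable and $\varepsilon>0$, form a neighborhood base at $f$. For a topological space $Y$ let $c(Y)$, the cellularity of $Y$, be the smallest infinite cardinal $\kappa$ such that every family of pairwise disjoint non-empty open subsets of $Y$ has cardinality at most $\kappa$. For an ordinal $\gamma$ let $[0,\gamma]$ be the space of all ordinals $\xi \le \gamma$ with its order topology. Let $\gamma$ be an ordinal. If $\gamma$ is countable, then $c(C_s([0,\gamma]))=\omega$; if $\gamma$ is uncountable, then $c(C_s([0,\gamma]))=\omega_1$. -/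

import Mathlib

open Cardinal Topology

universe u

/-- The cellularity (Souslin number) of a topological space: the smallest infinite cardinal `κ`
such that every family of pairwise disjoint nonempty open sets has cardinality at most `κ`. -/
noncomputable def cellularity (X : Type u) [TopologicalSpace X] : Cardinal.{u} :=
  sInf {κ : Cardinal.{u} | ℵ₀ ≤ κ ∧
    ∀ 𝒰 : Set (Set X), (∀ U ∈ 𝒰, IsOpen U ∧ U.Nonempty) → 𝒰.PairwiseDisjoint id → #𝒰 ≤ κ}

/-- The underlying set of the space `C_s(X)`: all continuous real-valued functions on `X`.
It is a type synonym, so that it does not carry the compact-open topology of `C(X, ℝ)`. -/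
def Cs (X : Type u) [TopologicalSpace X] : Type u := C(X, ℝ)

/-- An element of `C_s(X)`, seen as a continuous map. -/
def Cs.toContinuousMap {X : Type u} [TopologicalSpace X] (f : Cs X) : C(X, ℝ) := f

/-- `C_s(X)` as a set of functions from `X` to `ℝ`, where `X → ℝ` is given the topology of
uniform convergence on countable subsets of `X`. -/
def Cs.toUniformOnFun {X : Type u} [TopologicalSpace X] (f : Cs X) :
    UniformOnFun X ℝ {A : Set X | A.Countable} :=
  UniformOnFun.ofFun {A : Set X | A.Countable} f.toContinuousMap

/-- The topology of pseudouniform convergence on `C_s(X)`: uniform convergence on the countable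
subsets of `X`. -/
instance Cs.instTopologicalSpace (X : Type u) [TopologicalSpace X] : TopologicalSpace (Cs X) :=
  TopologicalSpace.induced Cs.toUniformOnFun inferInstance

/-- The sets `V(f, A, ε) = {g | ∀ x ∈ A, |f x - g x| < ε}`, with `A` countable and `ε > 0`, form a
neighbourhood base at `f` in `C_s(X)`. -/
theorem Cs.nhds_hasBasis {X : Type u} [TopologicalSpace X] (f : Cs X) :
    (𝓝 f).HasBasis (fun p : Set X × ℝ => p.1.Countable ∧ 0 < p.2)
      (fun p => {g : Cs X | ∀ x ∈ p.1, |f.toContinuousMap x - g.toContinuousMap x| < p.2}) := by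
  rw [nhds_induced]
  have h := UniformOnFun.hasBasis_nhds_of_basis X ℝ {A : Set X | A.Countable}
    f.toUniformOnFun ⟨∅, Set.countable_empty⟩
    (fun A hA B hB => ⟨A ∪ B, Set.Countable.union hA hB, by simp, by simp⟩)
    Metric.uniformity_basis_dist
  refine (h.comap Cs.toUniformOnFun).congr (fun _ => Iff.rfl) (fun p _ => ?_)
  ext g
  refine forall₂_congr fun x _ => ?_
  rw [abs_sub_comm]
  rfl

/-- The space `[0, γ]` of all ordinals at most `γ`. -/
abbrev OrdinalInterval (γ : Ordinal.{u}) : Type (u + 1) := Set.Iic γ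

/-- The topology of `[0, γ]` is its order topology. -/
theorem OrdinalInterval.orderTopology (γ : Ordinal.{u}) : OrderTopology (OrdinalInterval γ) :=
  inferInstance

/-! Upper bounds: by Urysohn, basic neighbourhoods of equal precision over closed countable sets
`A`, `B` meet once their centres are that close on `A ∩ B`. So disjoint open sets yield pairwise
incompatible triples `(f, A, k)`. Each `f` is nearly a step function with finitely many jumps and
rational values. Take `M` of size at most `ℵ₁`, closed under countable suprema and containing, for
each realized pattern over `M`, the set `A` of some member realizing it. Enclosing the jumps of `f`
between points of `M` gives a pattern whose chosen member is compatible with `f`, hence equal to it;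
so patterns over `M` bound the family (`mk_le_mk_stepPattern`). For countable `γ`, `M` is the whole
space. Lower bound: the indicators of `[0, a]`, `a < ω₁`, have disjoint neighbourhoods
(`mk_le_cellularity_Cs`). -/

section Closure

/-! ### Closing off in `ω₁` stages -/

/-- A set of cardinality at most `ℵ₁` that captures the values of an operator `step` on
sets containing any prescribed countable subset. -/
theorem exists_mk_le_aleph_one_capturing {X : Type u} (step : Set X → Set X)
    (hstep : ∀ N : Set X, #N ≤ ℵ₁ → #(step N) ≤ ℵ₁) :
    ∃ M : Set X, #M ≤ ℵ₁ ∧ ∀ B ⊆ M, B.Countable → ∃ N, B ⊆ N ∧ step N ⊆ M := by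
  let I : Type u := (ℵ₁ : Cardinal.{u}).ord.ToType
  have hI : #I = ℵ₁ := mk_ord_toType _
  have hlt : ∀ i : I, #(Set.Iio i) ≤ ℵ₀ := fun i => by
    have h := mk_Iio_lt i (by rw [hI]; exact (Ordinal.type_toType _).symm)
    exact Order.lt_succ_iff.1 (h.trans_eq (hI.trans succ_aleph0.symm))
  have wf : WellFounded (fun i j : I => i < j) := wellFounded_lt
  let G : I → Set X := wf.fix fun i ih => step (⋃ j : Set.Iio i, ih j.1 j.2)
  have hG : ∀ i, G i = step (⋃ j : Set.Iio i, G j.1) := fun i => wf.fix_eq _ i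
  have hunion : ∀ i, (∀ j < i, #(G j) ≤ ℵ₁) → #(⋃ j : Set.Iio i, G j.1 : Set X) ≤ ℵ₁ := by
    intro i ih
    refine (mk_iUnion_le _).trans ((mul_le_mul' ((hlt i).trans (aleph0_le_aleph 1))
      (ciSup_le' fun j : Set.Iio i => ih j.1 j.2)).trans ?_)
    rw [mul_eq_self (aleph0_le_aleph 1)]
  have hcard : ∀ i, #(G i) ≤ ℵ₁ := by
    intro i
    induction i using wf.induction with
    | _ i ih =>
      rw [hG]
      exact hstep _ (hunion i ih)
  refine ⟨⋃ i, G i, ?_, ?_⟩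
  · refine (mk_iUnion_le _).trans ((mul_le_mul' hI.le (ciSup_le' hcard)).trans ?_)
    rw [mul_eq_self (aleph0_le_aleph 1)]
  · intro B hB hBc
    have : Nonempty I := mk_ne_zero_iff.1 (hI ▸ (aleph_pos 1).ne')
    choose! idx hidx using fun x (hx : x ∈ B) => Set.mem_iUnion.1 (hB hx)
    -- Regularity of `ω₁`: a countable set of stages is bounded.
    obtain ⟨i, hi⟩ : ∃ i, ∀ x ∈ B, idx x < i := by
      by_contra! hcon
      have hc : (⋃ x ∈ B, Set.Iic (idx x)).Countable := by
        refine hBc.biUnion fun x _ => ?_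
        rw [← Set.Iio_insert]
        exact (le_aleph0_iff_set_countable.1 (hlt _)).insert _
      have huniv : (Set.univ : Set I).Countable := hc.mono fun i _ => by
        obtain ⟨x, hx, h⟩ := hcon i
        exact Set.mem_biUnion hx h
      have := Set.countable_univ_iff.1 huniv
      have h2 : #I ≤ ℵ₀ := mk_le_aleph0
      rw [hI] at h2
      exact absurd h2 (not_le.2 aleph0_lt_aleph_one)
    refine ⟨⋃ j : Set.Iio i, G j.1, fun x hx => Set.mem_iUnion.2 ⟨⟨idx x, hi x hx⟩, hidx x hx⟩, ?_⟩
    rw [← hG]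
    exact Set.subset_iUnion G i

end Closure

/-! ### Well-ordered spaces and step functions -/

section WellOrdered

variable {X : Type u} [LinearOrder X] [WellFoundedLT X]

/-- Send `s` to the least point of `N` above it, if any. If `s < t` and `t` is a supremum from `N`,
some point of `N` lies in `(s, t]`, so the images differ. -/
theorem mk_setOf_isLUB_le (N : Set X) : #{s | ∃ B ⊆ N, IsLUB B s} ≤ #N + 1 := by
  classical
  rw [← mk_option]
  let next : X → Option N := fun s =>
    if h : (N ∩ Set.Ioi s).Nonempty then
      some ⟨wellFounded_lt.min _ h, (wellFounded_lt.min_mem _ h).1⟩ else none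
  refine mk_le_of_injective (f := fun s : {s | ∃ B ⊆ N, IsLUB B s} => next s.1) ?_
  have key : ∀ s t : X, s < t → (∃ B ⊆ N, IsLUB B t) → next s ≠ next t := by
    rintro s t hst ⟨B, hBN, hB⟩ heq
    obtain ⟨x, hxB, hx⟩ : ∃ x ∈ B, s < x := by
      by_contra! hcon
      exact absurd (hB.2 hcon) (not_le.2 hst)
    have hs : (N ∩ Set.Ioi s).Nonempty := ⟨x, hBN hxB, hx⟩
    have hle : wellFounded_lt.min _ hs ≤ x := wellFounded_lt.min_le (s := N ∩ Set.Ioi s) ⟨hBN hxB, hx⟩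
    simp only [next, dif_pos hs] at heq
    split_ifs at heq with ht
    have h2 : wellFounded_lt.min _ hs = wellFounded_lt.min _ ht := by simpa using heq
    have h3 : t < wellFounded_lt.min _ ht := (wellFounded_lt.min_mem _ ht).2
    exact absurd (hle.trans (hB.1 hxB)) (not_le.2 (h2 ▸ h3))
  rintro ⟨s, hs⟩ ⟨t, ht⟩ h
  rcases lt_trichotomy s t with hlt | heq | hgt
  · exact absurd h (key s t hlt ht)
  · exact Subtype.ext heq
  · exact absurd h.symm (key t s hgt hs)

theorem exists_isLUB_of_wellFoundedLT [OrderTop X] (B : Set X) : ∃ s, IsLUB B s := by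
  have h : (upperBounds B).Nonempty := ⟨⊤, fun _ _ => le_top⟩
  exact ⟨wellFounded_lt.min _ h, wellFounded_lt.min_mem _ h,
    fun x hx => wellFounded_lt.min_le hx⟩

variable [TopologicalSpace X] [OrderTopology X]

theorem Iic_mem_nhds_of_wellFoundedLT (x : X) : Set.Iic x ∈ 𝓝 x := by
  by_cases h : (Set.Ioi x).Nonempty
  · refine Filter.mem_of_superset (Iio_mem_nhds (wellFounded_lt.min_mem _ h)) fun y hy => ?_
    exact not_lt.1 fun hxy => wellFounded_lt.not_lt_min (Set.Ioi x) hxy hy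
  · refine Filter.mem_of_superset Filter.univ_mem fun y _ => ?_
    exact not_lt.1 fun hxy => h ⟨y, hxy⟩

theorem isClopen_Iic_of_wellFoundedLT (x : X) : IsClopen (Set.Iic x) :=
  ⟨isClosed_Iic, isOpen_iff_mem_nhds.2 fun y hy =>
    Filter.mem_of_superset (Iic_mem_nhds_of_wellFoundedLT y) (Set.Iic_subset_Iic.2 hy)⟩

theorem Set.Countable.closure_of_wellFoundedLT {A : Set X} (hA : A.Countable) :
    (closure A).Countable := by
  have hsub : closure A ⊆ {s | ∃ B ⊆ A, IsLUB B s} := by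
    intro x hx
    refine ⟨A ∩ Set.Iic x, Set.inter_subset_left, fun y hy => hy.2, fun u hu => ?_⟩
    by_contra! hux
    obtain ⟨y, ⟨hy1, hy2⟩, hyA⟩ := mem_closure_iff_nhds.1 hx _
      (Filter.inter_mem (Iic_mem_nhds_of_wellFoundedLT x) (Ioi_mem_nhds hux))
    exact absurd (hu ⟨hyA, hy1⟩) (not_le.2 hy2)
  refine Set.Countable.mono hsub (le_aleph0_iff_set_countable.1 ((mk_setOf_isLUB_le A).trans ?_))
  exact add_le_aleph0.2 ⟨le_aleph0_iff_set_countable.2 hA, one_le_aleph0⟩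

/-- A continuous function oscillates little on each of the cells that finitely many points cut
out of a well-ordered space. -/
theorem exists_finset_cut_oscillation_lt [OrderTop X] (f : C(X, ℝ)) {ε : ℝ} (hε : 0 < ε) :
    ∃ F : Finset X, ∀ x y, (∀ a ∈ F, a < x ↔ a < y) → |f x - f y| < ε := by
  classical
  suffices h : ∀ d : X, ∃ F : Finset X, ∀ x ≤ d, ∀ y ≤ d,
      (∀ a ∈ F, a < x ↔ a < y) → |f x - f y| < ε by
    obtain ⟨F, hF⟩ := h ⊤
    exact ⟨F, fun x y => hF x le_top y le_top⟩
  intro d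
  induction d using WellFoundedLT.induction with
  | _ d ih =>
    by_cases hd : ∃ l, l < d
    · have hnhds : {x | |f x - f d| < ε / 2} ∈ 𝓝 d := by
        have := f.continuous.continuousAt (x := d) (Metric.ball_mem_nhds (f d) (half_pos hε))
        simpa [Metric.ball, Real.dist_eq] using this
      -- `f` is nearly constant on `(b, d]`; cutting at `b` leaves `[0, b]` to induction.
      obtain ⟨b, hbd, hb⟩ := exists_Ioc_subset_of_mem_nhds hnhds hd
      obtain ⟨F, hF⟩ := ih b hbd
      refine ⟨insert b F, fun x hx y hy h => ?_⟩
      have hbxy := h b (Finset.mem_insert_self b F)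
      by_cases hbx : b < x
      · have h1 : |f x - f d| < ε / 2 := hb ⟨hbx, hx⟩
        have h2 : |f y - f d| < ε / 2 := hb ⟨hbxy.1 hbx, hy⟩
        rw [abs_lt] at *
        constructor <;> linarith
      · exact hF x (not_lt.1 hbx) y (not_lt.1 fun hby => hbx (hbxy.2 hby))
          fun a ha => h a (Finset.mem_insert_of_mem ha)
    · refine ⟨∅, fun x hx y hy _ => ?_⟩
      have hx' : x = d := le_antisymm hx (not_lt.1 fun h => hd ⟨x, h⟩)
      have hy' : y = d := le_antisymm hy (not_lt.1 fun h => hd ⟨y, h⟩)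
      simpa [hx', hy'] using hε

/-- Rational values leave only countably many value tables `q` for each `n`. -/
theorem exists_step_approximation [OrderTop X] (f : C(X, ℝ)) {ε : ℝ} (hε : 0 < ε) :
    ∃ (n : ℕ) (a : Fin n → X) (q : (Fin n → Prop) → ℚ),
      ∀ x, |f x - q fun j => a j < x| < ε := by
  classical
  obtain ⟨F, hF⟩ := exists_finset_cut_oscillation_lt f (half_pos hε)
  let a : Fin F.card → X := fun j => (F.equivFin.symm j).1
  have hex : ∀ s : Fin F.card → Prop, ∃ r : ℚ, ∀ x, (fun j => a j < x) = s → |f x - r| < ε := by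
    intro s
    by_cases hs : ∃ y, (fun j => a j < y) = s
    · obtain ⟨y, hy⟩ := hs
      obtain ⟨r, hr1, hr2⟩ := exists_rat_btwn (show f y - ε / 2 < f y by linarith)
      refine ⟨r, fun x hx => ?_⟩
      have hxy := hF x y fun b hb => by
        have := congrFun (hx.trans hy.symm) (F.equivFin ⟨b, hb⟩)
        simpa [a] using this
      rw [abs_lt] at *
      constructor <;> linarith
    · exact ⟨0, fun x hx => absurd ⟨x, hx⟩ hs⟩
  choose q hq using hex
  exact ⟨F.card, a, q, fun x => hq _ x rfl⟩

end WellOrdered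

/-- Interpolate from `f` to `g` by a Urysohn function that is `0` on `A` and `1` where `f`, `g` are
far apart on `B`. -/
theorem exists_continuousMap_near_of_near_on_inter {X : Type u} [TopologicalSpace X] [NormalSpace X]
    (f g : C(X, ℝ)) {A B : Set X} (hA : IsClosed A) (hB : IsClosed B) {ε : ℝ} (hε : 0 < ε)
    (h : ∀ x ∈ A ∩ B, |f x - g x| < ε) :
    ∃ k : C(X, ℝ), (∀ x ∈ A, |f x - k x| < ε) ∧ ∀ x ∈ B, |g x - k x| < ε := by
  let C : Set X := B ∩ {x | ε ≤ |f x - g x|}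
  have hC : IsClosed C := hB.inter (isClosed_le continuous_const (by fun_prop))
  have hAC : Disjoint A C := Set.disjoint_left.2 fun x hx hxC =>
    absurd (h x ⟨hx, hxC.1⟩) (not_lt.2 hxC.2)
  obtain ⟨φ, hφA, hφC, hφ⟩ := exists_continuous_zero_one_of_isClosed hA hC hAC
  refine ⟨f + φ * (g - f), fun x hx => ?_, fun x hx => ?_⟩
  · have : φ x = 0 := hφA hx
    simpa [this] using hε
  · by_cases hxC : ε ≤ |f x - g x|
    · have : φ x = 1 := hφC ⟨hx, hxC⟩
      simpa [this] using hε
    · push Not at hxC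
      have heq : g x - (f + φ * (g - f)) x = -((1 - φ x) * (f x - g x)) := by
        simp only [ContinuousMap.add_apply, ContinuousMap.mul_apply, ContinuousMap.sub_apply]
        ring
      rw [heq, abs_neg, abs_mul, abs_of_nonneg (by linarith [(hφ x).2])]
      have h1 := (hφ x).1
      have h2 := abs_nonneg (f x - g x)
      nlinarith

/-! ### Patterns and the counting argument -/

/-- A finite description of a step function whose jumps are only known up to intervals with
end points in `N`, together with a precision. -/
def StepPattern (N : Type u) : Type u :=
  Σ n : ℕ, ℕ × (Fin n → N) × (Fin n → N) × ((Fin n → Prop) → ℚ)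

theorem mk_stepPattern_le {N : Type u} {κ : Cardinal.{u}} (hκ : ℵ₀ ≤ κ) (hN : #N ≤ κ) :
    #(StepPattern N) ≤ κ := by
  have hpow : ∀ n : ℕ, #(Fin n → N) ≤ κ := fun n => by
    have : #(Fin n → N) = #N ^ n := by simp
    rw [this]
    exact (power_le_power_right hN).trans (power_nat_le hκ)
  have hfib : ∀ n : ℕ,
      #(ℕ × (Fin n → N) × (Fin n → N) × ((Fin n → Prop) → ℚ)) ≤ κ := by
    intro n
    have h1 : lift.{u} #((Fin n → Prop) → ℚ) ≤ κ := by
      refine le_trans ?_ hκ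
      rw [lift_le_aleph0]
      exact mk_le_aleph0
    simp only [mk_prod, lift_id, lift_uzero, mk_nat, lift_aleph0]
    refine (mul_le_mul' (b := κ) (d := κ) hκ ((mul_le_mul' (b := κ) (d := κ) ?_
      ((mul_le_mul' (b := κ) (d := κ) ?_ h1).trans ?_)).trans ?_)).trans ?_
    · simpa using hpow n
    · simpa using hpow n
    all_goals exact (mul_eq_self hκ).le
  unfold StepPattern
  rw [mk_sigma]
  refine (sum_le_lift_mk_mul_iSup _).trans ?_
  refine (mul_le_mul' (b := κ) (d := κ) ?_ (ciSup_le' hfib)).trans (mul_eq_self hκ).le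
  simpa using hκ

namespace StepPattern

def map {N : Type u} {X : Type u} (e : N → X) (p : StepPattern N) : StepPattern X :=
  ⟨p.1, p.2.1, e ∘ p.2.2.1, e ∘ p.2.2.2.1, p.2.2.2.2⟩

/-- `f` is approximated with precision `1 / (2 * (k + 1))` by a step function that has the
pattern `p`, where `k` is the precision recorded in `p`. -/
def Realizes {X : Type u} [LinearOrder X] (p : StepPattern X) (f : X → ℝ) (k : ℕ) : Prop :=
  k = p.2.1 ∧ ∃ a : Fin p.1 → X,
    (∀ j, (p.2.2.1 j < a j ∧ a j < p.2.2.2.1 j) ∨ (p.2.2.1 j = a j ∧ a j = p.2.2.2.1 j)) ∧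
    ∀ x, |f x - p.2.2.2.2 fun j => a j < x| < 1 / (2 * (k + 1))

end StepPattern

section Families

variable {X : Type u} [LinearOrder X] [WellFoundedLT X] [OrderTop X] [TopologicalSpace X]
  [OrderTopology X] {ι : Type u}

/-- The members of a family of pairwise incompatible pairs of a function and a countable set are
determined by patterns over a set `M` that is closed under countable suprema and under the choice
of members with given patterns. -/
theorem mk_le_mk_stepPattern (f : ι → C(X, ℝ)) (A : ι → Set X) (k : ι → ℕ)
    (hA : ∀ i, (A i).Countable)
    (hcompat : ∀ i j, k i = k j → (∀ x ∈ A i ∩ A j, |f i x - f j x| < 1 / (k i + 1)) → i = j)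
    (M : Set X) (htop : ⊤ ∈ M) (hlub : ∀ B ⊆ M, B.Countable → ∀ s, IsLUB B s → s ∈ M)
    (hchoice : ∀ p : StepPattern M, ∀ i, (p.map Subtype.val).Realizes (f i) (k i) →
      ∃ j, (p.map Subtype.val).Realizes (f j) (k j) ∧ A j ⊆ M) :
    #ι ≤ #(StepPattern M) := by
  classical
  -- Moving a jump within its enclosure never crosses a point of `B ∩ M`.
  have hbounds : ∀ (B : Set X), B.Countable → ∀ a : X, ∃ l h : M,
      ((l.1 < a ∧ a < h.1) ∨ (l.1 = a ∧ a = h.1)) ∧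
      ∀ x ∈ B ∩ M, ∀ b : X, ((l.1 < b ∧ b < h.1) ∨ (l.1 = b ∧ b = h.1)) →
        (a < x ↔ b < x) := by
    intro B hB a
    by_cases ha : a ∈ M
    · refine ⟨⟨a, ha⟩, ⟨a, ha⟩, Or.inr ⟨rfl, rfl⟩, fun x _ b hb => ?_⟩
      have : a = b := by
        rcases hb with h | h
        · exact absurd (h.1.trans h.2) (lt_irrefl a)
        · exact h.1
      rw [this]
    · obtain ⟨l, hl⟩ := exists_isLUB_of_wellFoundedLT (B ∩ M ∩ Set.Iio a)
      have hlM : l ∈ M := hlub _ (fun x hx => hx.1.2)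
        (hB.mono fun x hx => hx.1.1) l hl
      have hla : l < a := lt_of_le_of_ne (hl.2 fun x hx => le_of_lt hx.2) fun h => ha (h ▸ hlM)
      have hne : (M ∩ Set.Ioi a).Nonempty :=
        ⟨⊤, htop, lt_of_le_of_ne le_top fun h => ha (h ▸ htop)⟩
      have hmem := wellFounded_lt.min_mem _ hne
      refine ⟨⟨l, hlM⟩, ⟨_, hmem.1⟩, Or.inl ⟨hla, hmem.2⟩, fun x hx b hb => ?_⟩
      have hb' : l < b ∧ b < wellFounded_lt.min _ hne := by
        rcases hb with h | h
        · exact h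
        · exact absurd (h.1.trans h.2) (hla.trans hmem.2).ne
      constructor
      · intro hax
        exact hb'.2.trans_le (wellFounded_lt.min_le (s := M ∩ Set.Ioi a) ⟨hx.2, hax⟩)
      · intro hbx
        by_contra! hxa
        have hxa' : x < a := lt_of_le_of_ne hxa fun h => ha (h ▸ hx.2)
        exact absurd (hl.1 ⟨hx, hxa'⟩) (not_le.2 (hb'.1.trans hbx))
  have hex : ∀ i, ∃ p : StepPattern M, (p.map Subtype.val).Realizes (f i) (k i) ∧
      ∀ j, (p.map Subtype.val).Realizes (f j) (k j) → A j ⊆ M → i = j := by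
    intro i
    have hpos : (0 : ℝ) < 1 / (2 * (k i + 1)) := by positivity
    obtain ⟨n, a, q, hq⟩ := exists_step_approximation (f i) hpos
    choose l h hlh hsep using fun t => hbounds (A i) (hA i) (a t)
    refine ⟨⟨n, k i, l, h, q⟩, ⟨rfl, a, hlh, hq⟩, ?_⟩
    intro j hj hAj
    obtain ⟨hk, b, hb, hbq⟩ : k j = k i ∧ ∃ b : Fin n → X,
        (∀ t, ((l t).1 < b t ∧ b t < (h t).1) ∨ ((l t).1 = b t ∧ b t = (h t).1)) ∧
        ∀ x, |f j x - q fun t => b t < x| < 1 / (2 * (k j + 1)) := hj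
    refine hcompat i j hk.symm fun x hx => ?_
    -- Since `x ∈ A i ∩ M`, both step functions take the same value at `x`; the two half-errors add
    -- up to `1 / (k + 1)`.
    have hcell : (fun t => a t < x) = fun t => b t < x := by
      funext t
      exact propext (hsep t x ⟨hx.1, hAj hx.2⟩ (b t) (hb t))
    have h1 := hq x
    have h2 : |f j x - q fun t => b t < x| < 1 / (2 * (k i + 1)) := by
      rw [← hk]; exact hbq x
    rw [← hcell] at h2
    have h3 : (1 : ℝ) / (k i + 1) = 1 / (2 * (k i + 1)) + 1 / (2 * (k i + 1)) := by
      field_simp; norm_num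
    rw [h3]
    rw [abs_lt] at *
    constructor <;> linarith
  choose p hp huniq using hex
  choose c hc hcA using fun i => hchoice (p i) i (hp i)
  refine mk_le_of_injective (f := p) fun i j hij => ?_
  have h1 := huniq i (c i) (hc i) (hcA i)
  have h2 := huniq j (c i) (hij ▸ hc i) (hcA i)
  exact h1.trans h2.symm

theorem mk_le_aleph0_of_incompatible [Countable X] (f : ι → C(X, ℝ)) (A : ι → Set X) (k : ι → ℕ)
    (hcompat : ∀ i j, k i = k j → (∀ x ∈ A i ∩ A j, |f i x - f j x| < 1 / (k i + 1)) → i = j) :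
    #ι ≤ ℵ₀ := by
  refine (mk_le_mk_stepPattern f A k (fun i => Set.to_countable _) hcompat Set.univ trivial
    (fun _ _ _ _ _ => trivial) fun p i hi => ⟨i, hi, Set.subset_univ _⟩).trans ?_
  exact mk_stepPattern_le le_rfl mk_le_aleph0

theorem mk_le_aleph_one_of_incompatible (f : ι → C(X, ℝ)) (A : ι → Set X) (k : ι → ℕ)
    (hA : ∀ i, (A i).Countable)
    (hcompat : ∀ i j, k i = k j → (∀ x ∈ A i ∩ A j, |f i x - f j x| < 1 / (k i + 1)) → i = j) :
    #ι ≤ ℵ₁ := by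
  classical
  let S : StepPattern X → Set X := fun p =>
    if h : ∃ i, p.Realizes (f i) (k i) then A h.choose else ∅
  have hS : ∀ p, (S p).Countable := fun p => by
    simp only [S]
    split_ifs with h
    · exact hA _
    · exact Set.countable_empty
  let step : Set X → Set X := fun N =>
    insert ⊤ {s | ∃ B ⊆ N, IsLUB B s} ∪ ⋃ p : StepPattern N, S (p.map Subtype.val)
  have h1 : (1 : Cardinal.{u}) ≤ ℵ₁ := one_le_aleph0.trans (aleph0_le_aleph 1)
  have hstep : ∀ N : Set X, #N ≤ ℵ₁ → #(step N) ≤ ℵ₁ := by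
    intro N hN
    refine (mk_union_le _ _).trans (add_le_of_le (aleph0_le_aleph 1) ?_ ?_)
    · exact mk_insert_le.trans (add_le_of_le (aleph0_le_aleph 1)
        ((mk_setOf_isLUB_le N).trans (add_le_of_le (aleph0_le_aleph 1) hN h1)) h1)
    · refine (mk_iUnion_le _).trans ((mul_le_mul' (mk_stepPattern_le (aleph0_le_aleph 1) hN)
        (ciSup_le' fun p => (le_aleph0_iff_set_countable.2 (hS _)).trans
          (aleph0_le_aleph 1))).trans ?_)
      rw [mul_eq_self (aleph0_le_aleph 1)]
  obtain ⟨M, hM, hcl⟩ := exists_mk_le_aleph_one_capturing step hstep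
  refine (mk_le_mk_stepPattern f A k hA hcompat M ?_ ?_ ?_).trans
    (mk_stepPattern_le (aleph0_le_aleph 1) hM)
  · obtain ⟨N, -, hN⟩ := hcl ∅ (Set.empty_subset _) Set.countable_empty
    exact hN (Or.inl (Set.mem_insert _ _))
  · intro B hBM hB s hs
    obtain ⟨N, hBN, hN⟩ := hcl B hBM hB
    exact hN (Or.inl (Set.mem_insert_of_mem _ ⟨B, hBN, hs⟩))
  · rintro ⟨n, m, l, h, q⟩ i hi
    -- A pattern has finitely many end points, so it already lives over one captured `N`.
    obtain ⟨N, hBN, hN⟩ := hcl (Set.range (Subtype.val ∘ l) ∪ Set.range (Subtype.val ∘ h))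
      (by rintro _ (⟨t, rfl⟩ | ⟨t, rfl⟩) <;> exact Subtype.property _)
      ((Set.countable_range _).union (Set.countable_range _))
    let p' : StepPattern N := ⟨n, m, fun t => ⟨l t, hBN (Or.inl ⟨t, rfl⟩)⟩,
      fun t => ⟨h t, hBN (Or.inr ⟨t, rfl⟩)⟩, q⟩
    have hex : ∃ i, (p'.map Subtype.val).Realizes (f i) (k i) := ⟨i, hi⟩
    refine ⟨hex.choose, hex.choose_spec, fun x hx => hN (Or.inr (Set.mem_iUnion.2 ⟨p', ?_⟩))⟩
    simp only [S, dif_pos hex]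
    exact hx

end Families

/-! ### Cellularity bounds for `C_s(X)` -/

section Cellularity

theorem aleph0_le_cellularity {Y : Type u} [TopologicalSpace Y] : ℵ₀ ≤ cellularity Y := by
  refine le_csInf ⟨max ℵ₀ #(Set Y), le_max_left _ _, fun 𝒰 _ _ =>
    (mk_set_le 𝒰).trans (le_max_right _ _)⟩ fun κ hκ => hκ.1

theorem mk_le_cellularity {Y : Type u} [TopologicalSpace Y] {𝒰 : Set (Set Y)}
    (h𝒰 : ∀ U ∈ 𝒰, IsOpen U ∧ U.Nonempty) (hd : 𝒰.PairwiseDisjoint id) :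
    #𝒰 ≤ cellularity Y := by
  refine le_csInf ⟨max ℵ₀ #(Set Y), le_max_left _ _, fun 𝒱 _ _ =>
    (mk_set_le 𝒱).trans (le_max_right _ _)⟩ fun κ hκ => hκ.2 𝒰 h𝒰 hd

variable {X : Type u} [LinearOrder X] [WellFoundedLT X] [TopologicalSpace X] [OrderTopology X]

/-- A disjoint family of nonempty open sets of `C_s(X)` is given by pairwise incompatible basic
neighbourhoods. -/
theorem exists_incompatible_of_pairwiseDisjoint {𝒰 : Set (Set (Cs X))}
    (h𝒰 : ∀ U ∈ 𝒰, IsOpen U ∧ U.Nonempty) (hd : 𝒰.PairwiseDisjoint id) :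
    ∃ (f : 𝒰 → C(X, ℝ)) (A : 𝒰 → Set X) (k : 𝒰 → ℕ), (∀ U, (A U).Countable) ∧
      ∀ U V, k U = k V → (∀ x ∈ A U ∩ A V, |f U x - f V x| < 1 / (k U + 1)) → U = V := by
  have hex : ∀ U : 𝒰, ∃ (f : C(X, ℝ)) (A : Set X) (k : ℕ), A.Countable ∧ IsClosed A ∧
      ∀ g : C(X, ℝ), (∀ x ∈ A, |f x - g x| < 1 / (k + 1)) → g ∈ U.1 := by
    intro U
    obtain ⟨hU, f, hf⟩ := h𝒰 U.1 U.2
    obtain ⟨⟨A, ε⟩, ⟨hA, hε⟩, hsub⟩ := (Cs.nhds_hasBasis f).mem_iff.1 (hU.mem_nhds hf)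
    obtain ⟨k, hk⟩ := exists_nat_one_div_lt hε
    exact ⟨f.toContinuousMap, closure A, k, hA.closure_of_wellFoundedLT, isClosed_closure,
      -- The closure is still countable, and closedness is needed for Urysohn.
      fun g hg => hsub fun x hx => (hg x (subset_closure hx)).trans hk⟩
  choose f A k hA hcl hmem using hex
  refine ⟨f, A, k, hA, fun U V hk h => ?_⟩
  obtain ⟨g, hgU, hgV⟩ := exists_continuousMap_near_of_near_on_inter (f U) (f V) (hcl U) (hcl V)
    (by positivity : (0 : ℝ) < 1 / (k U + 1)) h
  rw [hk] at hgV
  exact Subtype.ext (hd.elim_set U.2 V.2 g (hmem U g (hk ▸ hgU)) (hmem V g hgV))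

theorem cellularity_Cs_of_countable [OrderTop X] [Countable X] : cellularity (Cs X) = ℵ₀ := by
  refine le_antisymm (csInf_le' ⟨le_rfl, fun 𝒰 h𝒰 hd => ?_⟩) aleph0_le_cellularity
  obtain ⟨f, A, k, -, h⟩ := exists_incompatible_of_pairwiseDisjoint h𝒰 hd
  exact mk_le_aleph0_of_incompatible f A k h

theorem cellularity_Cs_le_aleph_one [OrderTop X] : cellularity (Cs X) ≤ ℵ₁ := by
  refine csInf_le' ⟨aleph0_le_aleph 1, fun 𝒰 h𝒰 hd => ?_⟩
  obtain ⟨f, A, k, hA, h⟩ := exists_incompatible_of_pairwiseDisjoint h𝒰 hd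
  exact mk_le_aleph_one_of_incompatible f A k hA h

/-- Points with countably many predecessors, none of them maximal, give disjoint open sets. -/
theorem mk_le_cellularity_Cs {I : Set X} (hI : ∀ a ∈ I, (Set.Iic a).Countable)
    (hmax : ∀ a ∈ I, ¬ IsMax a) : #I ≤ cellularity (Cs X) := by
  classical
  have hnext : ∀ a : I, ∃ b, a.1 < b ∧ ∀ c, a.1 < c → b ≤ c := fun a => by
    have hne : (Set.Ioi a.1).Nonempty := not_isMax_iff.1 (hmax a a.2)
    exact ⟨wellFounded_lt.min _ hne, wellFounded_lt.min_mem _ hne,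
      fun c hc => wellFounded_lt.min_le (s := Set.Ioi a.1) hc⟩
  choose s hs hsle using hnext
  let F : I → C(X, ℝ) := fun a => ⟨(Set.Iic a.1).indicator 1,
    (isClopen_Iic_of_wellFoundedLT a.1).continuous_indicator continuous_const⟩
  -- For `a < b`, the indicators take values `0` and `1` at the successor `s a ≤ b`, so radius `1 /
  -- 2` separates them.
  let N : I → Set (Cs X) := fun a =>
    {g : Cs X | ∀ x ∈ insert (s a) (Set.Iic a.1), |(F a) x - g.toContinuousMap x| < 1 / 2}
  have hN : ∀ a, N a ∈ @nhds (Cs X) _ (F a) := fun a =>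
    (Cs.nhds_hasBasis (F a : Cs X)).mem_of_mem
      (i := (insert (s a) (Set.Iic a.1), (1 / 2 : ℝ))) ⟨(hI a a.2).insert _, by norm_num⟩
  have hlt : ∀ a b : I, a.1 < b.1 → Disjoint (N a) (N b) := by
    intro a b hab
    refine Set.disjoint_left.2 fun g hga hgb => ?_
    have h1 := hga (s a) (Set.mem_insert _ _)
    have h2 := hgb (s a) (Set.mem_insert_of_mem _ (hsle a b hab))
    have e1 : F a (s a) = 0 := Set.indicator_of_notMem (s := Set.Iic a.1) (not_le.2 (hs a)) _
    have e2 : F b (s a) = 1 := Set.indicator_of_mem (s := Set.Iic b.1) (hsle a b hab) _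
    rw [e1, abs_lt] at h1
    rw [e2, abs_lt] at h2
    linarith [h1.1, h2.2]
  have hdis : ∀ a b : I, a ≠ b → Disjoint (interior (N a)) (interior (N b)) := by
    intro a b hab
    refine Disjoint.mono interior_subset interior_subset ?_
    rcases lt_or_gt_of_ne (Subtype.coe_ne_coe.2 hab) with h | h
    · exact hlt a b h
    · exact (hlt b a h).symm
  have hne : ∀ a, (interior (N a)).Nonempty := fun a => ⟨F a, mem_interior_iff_mem_nhds.2 (hN a)⟩
  have hinj : Function.Injective fun a => interior (N a) := by
    intro a b hab
    by_contra hne'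
    have h := hdis a b hne'
    have hab' : interior (N a) = interior (N b) := hab
    rw [← hab', disjoint_self] at h
    exact (hne a).ne_empty h
  rw [← mk_range_eq _ hinj]
  refine mk_le_cellularity ?_ ?_
  · rintro _ ⟨a, rfl⟩
    exact ⟨isOpen_interior, hne a⟩
  · rintro _ ⟨a, rfl⟩ _ ⟨b, rfl⟩ hab
    exact hdis a b fun h => hab (h ▸ rfl)

end Cellularity

theorem countable_Iic_of_card_le_aleph0 {γ : Ordinal.{u}} (h : γ.card ≤ ℵ₀) :
    (Set.Iic γ).Countable := by
  rw [← Set.Iio_insert]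
  refine Set.Countable.insert _ (le_aleph0_iff_set_countable.1 ?_)
  rw [mk_Iio_ordinal, lift_le_aleph0]
  exact h

theorem mainTheorem3 (γ : Ordinal.{u}) :
    (γ.card ≤ ℵ₀ → cellularity (Cs (OrdinalInterval γ)) = ℵ₀) ∧
      (ℵ₀ < γ.card → cellularity (Cs (OrdinalInterval γ)) = ℵ₁) := by
  constructor
  · intro h
    have : Countable (OrdinalInterval γ) := (countable_Iic_of_card_le_aleph0 h).to_subtype
    exact cellularity_Cs_of_countable
  · intro h
    refine le_antisymm cellularity_Cs_le_aleph_one ?_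
    have hω : Ordinal.omega 1 ≤ γ := by
      rw [← ord_aleph, ord_le, aleph_one_le_iff]
      exact h
    let e : Set.Iio (Ordinal.omega.{u} 1) → OrdinalInterval γ := fun a => ⟨a.1, a.2.le.trans hω⟩
    have he : Function.Injective e := fun a b hab => Subtype.ext (Subtype.mk.inj hab)
    have hcard : #(Set.range e) = ℵ₁ := by
      rw [mk_range_eq _ he, mk_Iio_ordinal]
      simp
    rw [← hcard]
    refine mk_le_cellularity_Cs ?_ ?_
    · rintro _ ⟨a, rfl⟩
      have ha : a.1.card ≤ ℵ₀ := by
        have := lt_ord.1 (a.2.trans_eq (ord_aleph 1).symm)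
        rwa [← Order.lt_succ_iff, succ_aleph0]
      exact ((countable_Iic_of_card_le_aleph0 ha).preimage Subtype.val_injective).mono
        fun x hx => hx
    · rintro _ ⟨a, rfl⟩
      exact not_isMax_iff.2 ⟨⊤, Subtype.mk_lt_mk.2 (a.2.trans_le hω)⟩
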